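/- Equip $\mathbb{R}^3$ with the standard contact structure $\xi=\ker(dz-y\,dx)$. A Legendrian $\theta$-graph consists of two vertices $a,b$ and three embedded smooth regular arcs (edges) from $a$ to $b$, tangent to $\xi$, disjoint except at $a$ and $b$, such that at each vertex no two of the outward pointing tangent vectors of the edges have the same direction. Let $G$ be a Legendrian $\theta$-graph which is in standard form near its two vertices: in the front projection (to the $xz$-plane), the three strands near $a$ lie to the right of $a$ and the three strands near $b$ lie to the left of $b$, each of them being there a graph over the $x$-axis. Denote by $e_1$, $e_2$, $e_3$ the edges which are, near $a$ in the front projection, the top, the middle and the lower strand, respectively. Let $\mathcal{C}_1$ be the oriented cycle which exits $a$ along $e_1$ and enters $a$ along $e_2$, let $\mathcal{C}_2$ be the oriented cycle which exits $a$ along $e_1$ and enters $a$ along $e_3$, and let $\mathcal{C}_3$ be the oriented cycle which exits $a$ along $e_2$ and enters $a$ along $e_3$. For $i=1,2,3$ let $rot_i$ be the rotation number of the piecewise smooth Legendrian knot $\mathcal{C}_i$, i.e. the winding number about the origin of its tangent vector with respect to the trivialization $\left(\frac{\partial}{\partial y},\,-y\frac{\partial}{\partial z}-\frac{\partial}{\partial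 x}\right)$ of $\xi$, where at a vertex the tangent vector turns inside the contact plane from the incoming to the outgoing direction through the angle in $(-\pi,\pi)$. Then $rot_1$, $rot_2$, $rot_3$ are integers, and $$rot_1-rot_2+rot_3\in\{0,-1\}.$$ -/

import Mathlib

open Set
open scoped ContDiff

/-- The space `ℝ³`, with coordinates `x = p 0`, `y = p 1`, `z = p 2`. -/
abbrev R3 : Type := EuclideanSpace ℝ (Fin 3)

/-- The standard contact form `α = dz - y dx` at the point `p`, applied to the vector `v`. -/
def contactForm (p v : R3) : ℝ := v 2 - p 1 * v 0

/-- The standard contact plane at `p`, i.e. the kernel of `dz - y dx`. -/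
def contactPlane (p : R3) : Set R3 := {v | contactForm p v = 0}

/-- First vector `d₁ = ∂/∂y` of the global frame of the standard contact structure. -/
noncomputable def frameOne : R3 := !₂[0, 1, 0]

/-- Second vector `d₂ = -y ∂/∂z - ∂/∂x` of the global frame of the standard contact structure. -/
noncomputable def frameTwo (p : R3) : R3 := !₂[-1, 0, -p 1]

/-- The coordinates of a vector of a contact plane in the frame `(d₁, d₂)`, as a complex number
(see `eq_frameCoord_smul_add`). -/
noncomputable def frameCoord (v : R3) : ℂ := ⟨v 1, -v 0⟩

theorem eq_frameCoord_smul_add {p v : R3} (h : v ∈ contactPlane p) :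
    v = (frameCoord v).re • frameOne + (frameCoord v).im • frameTwo p := by
  have h' : v 2 - p 1 * v 0 = 0 := h
  ext i
  fin_cases i <;> simp [frameCoord, frameOne, frameTwo]
  linarith

/-- A smooth regular curve `[0,1] → ℝ³` tangent to the standard contact structure. -/
structure LegendrianCurve where
  /-- The curve; only its values on `[0,1]` matter. -/
  toFun : ℝ → R3
  smooth : ContDiffOn ℝ ∞ toFun (Icc 0 1)
  regular : ∀ t ∈ Icc (0 : ℝ) 1, derivWithin toFun (Icc 0 1) t ≠ 0
  legendrian : ∀ t ∈ Icc (0 : ℝ) 1, derivWithin toFun (Icc 0 1) t ∈ contactPlane (toFun t)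

namespace LegendrianCurve

instance : CoeFun LegendrianCurve (fun _ => ℝ → R3) := ⟨LegendrianCurve.toFun⟩

/-- The velocity of the curve (one-sided at the end points). -/
noncomputable def velocity (γ : LegendrianCurve) (t : ℝ) : R3 :=
  derivWithin γ.toFun (Icc 0 1) t

/-- The velocity of the curve in the frame `(d₁, d₂)` of the contact structure. -/
noncomputable def direction (γ : LegendrianCurve) (t : ℝ) : ℂ :=
  frameCoord (γ.velocity t)

/-- The total variation `∫ dθ` of the angle `θ` of the velocity along the curve, where the angle is
measured in the frame `(d₁, d₂)` of the contact structure. -/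
noncomputable def angleVariation (γ : LegendrianCurve) : ℝ :=
  ∫ t in (0 : ℝ)..1, (derivWithin γ.direction (Icc 0 1) t / γ.direction t).im

theorem derivWithin_reverse (f : ℝ → R3) (t : ℝ) :
    derivWithin (fun s => f (1 - s)) (Icc 0 1) t = -derivWithin f (Icc 0 1) (1 - t) := by
  rw [derivWithin_comp_const_sub]
  simp

/-- The same curve with the opposite orientation. -/
def reverse (γ : LegendrianCurve) : LegendrianCurve where
  toFun := fun t => γ (1 - t)
  smooth := by
    refine γ.smooth.comp (contDiff_const.sub contDiff_id).contDiffOn ?_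
    intro t ht
    exact ⟨by linarith [ht.2], by linarith [ht.1]⟩
  regular := by
    intro t ht
    rw [derivWithin_reverse]
    exact neg_ne_zero.2 (γ.regular _ ⟨by linarith [ht.2], by linarith [ht.1]⟩)
  legendrian := by
    intro t ht
    rw [derivWithin_reverse]
    have h : contactForm (γ (1 - t)) (derivWithin γ.toFun (Icc 0 1) (1 - t)) = 0 :=
      γ.legendrian (1 - t) ⟨by linarith [ht.2], by linarith [ht.1]⟩
    simp only [contactPlane, contactForm, mem_ofPred_eq, PiLp.neg_apply] at h ⊢
    linarith

theorem reverse_apply (γ : LegendrianCurve) (t : ℝ) : γ.reverse t = γ (1 - t) := rfl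

theorem velocity_reverse (γ : LegendrianCurve) (t : ℝ) :
    γ.reverse.velocity t = -γ.velocity (1 - t) :=
  derivWithin_reverse _ _

end LegendrianCurve

/-- An oriented piecewise smooth Legendrian knot: a simple closed curve which is the cyclic
concatenation of `n` Legendrian curves, such that at every corner the two outward pointing
tangent vectors do not have the same direction. -/
structure PiecewiseLegendrianKnot (n : ℕ) [NeZero n] where
  /-- The smooth pieces, in cyclic order. -/
  arc : Fin n → LegendrianCurve
  closes : ∀ k, arc k 1 = arc (k + 1) 0
  simple : ∀ k l, ∀ s ∈ Ico (0 : ℝ) 1, ∀ t ∈ Ico (0 : ℝ) 1, arc k s = arc l t → k = l ∧ s = t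
  nontangent : ∀ k, ¬ SameRay ℝ (-(arc k).velocity 1) ((arc (k + 1)).velocity 0)

/-- The rotation number of an oriented piecewise smooth Legendrian knot: the winding number about
the origin of its tangent vector, written in the frame `(d₁, d₂)` of the contact structure. At a
corner the tangent vector turns inside the contact plane from the incoming to the outgoing
direction through the angle in `(-π, π)` (it is never `π`, because of `nontangent`). -/
noncomputable def PiecewiseLegendrianKnot.rotationNumber {n : ℕ} [NeZero n]
    (K : PiecewiseLegendrianKnot n) : ℝ :=
  (∑ k, (K.arc k).angleVariation +
    ∑ k, Complex.arg ((K.arc (k + 1)).direction 0 / (K.arc k).direction 1)) / (2 * Real.pi)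

/-- A Legendrian `θ`-graph in `ℝ³` with its standard contact structure: two vertices `a`, `b` and
three embedded Legendrian edges from `a` to `b`, disjoint except at the vertices, such that no two
outward pointing tangent vectors at a vertex have the same direction. -/
structure LegendrianThetaGraph where
  a : R3
  b : R3
  /-- The edges `e₁ = edge 0`, `e₂ = edge 1`, `e₃ = edge 2`, parametrized from `a` to `b`. -/
  edge : Fin 3 → LegendrianCurve
  source : ∀ i, edge i 0 = a
  target : ∀ i, edge i 1 = b
  injOn : ∀ i, InjOn (edge i) (Icc 0 1)
  disjoint : ∀ i j, i ≠ j → ∀ s ∈ Icc (0 : ℝ) 1, ∀ t ∈ Icc (0 : ℝ) 1,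
    edge i s = edge j t → (s = 0 ∧ t = 0) ∨ (s = 1 ∧ t = 1)
  nontangent_a : ∀ i j, i ≠ j → ¬ SameRay ℝ ((edge i).velocity 0) ((edge j).velocity 0)
  nontangent_b : ∀ i j, i ≠ j → ¬ SameRay ℝ (-(edge i).velocity 1) (-(edge j).velocity 1)

namespace LegendrianThetaGraph

/-- In the front projection (to the `xz`-plane), the three strands near `a` are graphs over `x` to
the right of `a`, and the three strands near `b` are graphs over `x` to the left of `b`. -/
structure IsStandardNearVertices (G : LegendrianThetaGraph) : Prop where
  right_of_a : ∃ ε ∈ Ioc (0 : ℝ) 1, ∀ i, StrictMonoOn (fun t => G.edge i t 0) (Icc 0 ε)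
  left_of_b : ∃ ε ∈ Ioc (0 : ℝ) 1, ∀ i, StrictMonoOn (fun t => G.edge i t 0) (Icc (1 - ε) 1)

/-- In the front projection near `a`, the edge `e₁` is the top strand, `e₂` is the middle strand and
`e₃` is the lower strand: where the strands have the same `x`, they have decreasing `z`. -/
def IsOrderedAtA (G : LegendrianThetaGraph) : Prop :=
  ∃ ε ∈ Ioc (0 : ℝ) 1, ∀ i j, i < j → ∀ s ∈ Ioc (0 : ℝ) ε, ∀ t ∈ Ioc (0 : ℝ) ε,
    G.edge i s 0 = G.edge j t 0 → G.edge j t 2 < G.edge i s 2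

/-- The oriented cycle which exits `a` along the edge `i` and enters `a` along the edge `j`. -/
def cycle (G : LegendrianThetaGraph) (i j : Fin 3) (hij : i ≠ j) : PiecewiseLegendrianKnot 2 where
  arc := ![G.edge i, (G.edge j).reverse]
  closes := by
    intro k
    fin_cases k
    · simp [LegendrianCurve.reverse_apply, G.target]
    · simp [LegendrianCurve.reverse_apply, G.source]
  simple := by
    have key : ∀ s ∈ Ico (0 : ℝ) 1, ∀ t ∈ Ico (0 : ℝ) 1, G.edge i s ≠ G.edge j (1 - t) := by
      intro s hs t ht h
      rcases G.disjoint i j hij s ⟨hs.1, hs.2.le⟩ (1 - t)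
        ⟨by linarith [ht.2], by linarith [ht.1]⟩ h with h | h
      · linarith [ht.2, h.2]
      · linarith [hs.2, h.1]
    intro k l s hs t ht h
    fin_cases k <;> fin_cases l
    · exact ⟨rfl, G.injOn i ⟨hs.1, hs.2.le⟩ ⟨ht.1, ht.2.le⟩ h⟩
    · exact (key s hs t ht h).elim
    · exact (key t ht s hs h.symm).elim
    · refine ⟨rfl, ?_⟩
      have := G.injOn j (x₁ := 1 - s) (x₂ := 1 - t) ⟨by linarith [hs.2], by linarith [hs.1]⟩
        ⟨by linarith [ht.2], by linarith [ht.1]⟩ h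
      linarith
  nontangent := by
    intro k
    fin_cases k
    · simpa [LegendrianCurve.velocity_reverse] using G.nontangent_b i j hij
    · simpa [LegendrianCurve.velocity_reverse] using G.nontangent_a j i hij.symm

/-- `C₁` exits `a` along `e₁` and enters `a` along `e₂`. -/
def cycleOne (G : LegendrianThetaGraph) : PiecewiseLegendrianKnot 2 := G.cycle 0 1 (by decide)

/-- `C₂` exits `a` along `e₁` and enters `a` along `e₃`. -/
def cycleTwo (G : LegendrianThetaGraph) : PiecewiseLegendrianKnot 2 := G.cycle 0 2 (by decide)

/-- `C₃` exits `a` along `e₂` and enters `a` along `e₃`. -/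
def cycleThree (G : LegendrianThetaGraph) : PiecewiseLegendrianKnot 2 := G.cycle 1 2 (by decide)

end LegendrianThetaGraph

/-! Multiplication by `I` turns frame coordinates into Lagrangian velocities `x' + i y'` and leaves
quotients, hence corner angles, unchanged. In standard form these velocities at the vertices lie in
the closed right half plane, with arguments in `[-π/2, π/2]`. So a corner angle `arg (-u / w)` is
`arg u - arg w` minus or plus `π`, according to which argument is larger.

In `rot₁ - rot₂ + rot₃` all edge variations and argument differences cancel; only the `±π` remain.
At `a` the sign is always minus: since `y = dz/dx`, the strands share their front tangent, and the
height order is the order of `y'/x'`, the second derivative of the front (possibly infinite). At `b`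
the sign depends on the angular order there. Each cycle is left with `0` or `-2π`, and transitivity
of the order at `b` excludes the alternating sums `1` and `-2`. -/

namespace LegendrianCurve

/-! ### Velocity and variation of its angle -/

theorem hasDerivWithinAt (γ : LegendrianCurve) {t : ℝ} (ht : t ∈ Icc (0 : ℝ) 1) :
    HasDerivWithinAt γ.toFun (γ.velocity t) (Icc 0 1) t :=
  ((γ.smooth.differentiableOn (by simp)) t ht).hasDerivWithinAt

theorem hasDerivWithinAt_coord (γ : LegendrianCurve) (i : Fin 3) {t : ℝ}
    (ht : t ∈ Icc (0 : ℝ) 1) :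
    HasDerivWithinAt (fun s => γ s i) (γ.velocity t i) (Icc 0 1) t :=
  (EuclideanSpace.proj (𝕜 := ℝ) i).hasFDerivAt.comp_hasDerivWithinAt t (γ.hasDerivWithinAt ht)

theorem velocity_two (γ : LegendrianCurve) {t : ℝ} (ht : t ∈ Icc (0 : ℝ) 1) :
    γ.velocity t 2 = γ t 1 * γ.velocity t 0 :=
  sub_eq_zero.1 (γ.legendrian t ht)

theorem direction_ne_zero (γ : LegendrianCurve) {t : ℝ} (ht : t ∈ Icc (0 : ℝ) 1) :
    γ.direction t ≠ 0 := by
  intro h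
  have h1 : γ.velocity t 1 = 0 := congrArg Complex.re h
  have h0 : γ.velocity t 0 = 0 := neg_eq_zero.1 (congrArg Complex.im h)
  refine γ.regular t ht ?_
  change γ.velocity t = 0
  ext i
  fin_cases i
  · exact h0
  · exact h1
  · simpa [h0] using γ.velocity_two ht

theorem direction_eq (γ : LegendrianCurve) (t : ℝ) :
    γ.direction t = (γ.velocity t 1 : ℂ) - (γ.velocity t 0 : ℂ) * Complex.I := by
  apply Complex.ext <;> simp [direction, frameCoord]

theorem contDiffOn_direction (γ : LegendrianCurve) :
    ContDiffOn ℝ ∞ γ.direction (Icc 0 1) := by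
  have hv : ContDiffOn ℝ ∞ γ.velocity (Icc 0 1) :=
    γ.smooth.derivWithin (uniqueDiffOn_Icc zero_lt_one) (by simp)
  have hc (i : Fin 3) : ContDiffOn ℝ ∞ (fun t => (γ.velocity t i : ℂ)) (Icc 0 1) :=
    (Complex.ofRealCLM.comp (EuclideanSpace.proj (𝕜 := ℝ) i)).contDiff.comp_contDiffOn hv
  exact ((hc 1).sub ((hc 0).mul contDiffOn_const)).congr fun t _ => γ.direction_eq t

theorem direction_reverse (γ : LegendrianCurve) (t : ℝ) :
    γ.reverse.direction t = -γ.direction (1 - t) := by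
  rw [direction, direction, velocity_reverse]
  apply Complex.ext <;> simp [frameCoord]

theorem angleVariation_reverse (γ : LegendrianCurve) :
    γ.reverse.angleVariation = -γ.angleVariation := by
  have hd (t : ℝ) : derivWithin γ.reverse.direction (Icc 0 1) t =
      derivWithin γ.direction (Icc 0 1) (1 - t) := by
    have h : γ.reverse.direction = fun s => -γ.direction (1 - s) :=
      funext γ.direction_reverse
    rw [h, derivWithin.fun_neg, derivWithin_comp_const_sub]
    simp
  have h := intervalIntegral.integral_comp_sub_left (a := 0) (b := 1)
    (fun t => (derivWithin γ.direction (Icc 0 1) t / γ.direction t).im) 1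
  simp only [sub_self, sub_zero] at h
  rw [angleVariation, angleVariation, ← h, ← intervalIntegral.integral_neg]
  refine intervalIntegral.integral_congr fun t _ => ?_
  simp only [hd, direction_reverse, div_neg, Complex.neg_im]

/-- The total variation of the angle of the velocity is, modulo `2π`, the angle from the initial
to the final velocity. -/
theorem coe_angleVariation (γ : LegendrianCurve) :
    (γ.angleVariation : Real.Angle) =
      (Complex.arg (γ.direction 1) : Real.Angle) - Complex.arg (γ.direction 0) := by
  set g : ℝ → ℂ := fun t => derivWithin γ.direction (Icc 0 1) t / γ.direction t with hg
  have hgc : ContinuousOn g (Icc 0 1) :=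
    (γ.contDiffOn_direction.continuousOn_derivWithin (uniqueDiffOn_Icc zero_lt_one)
      (by simp)).div γ.contDiffOn_direction.continuousOn fun t ht => γ.direction_ne_zero ht
  -- The continuous extension to `ℝ` makes the primitive `F` differentiable at the end points too.
  set g' : ℝ → ℂ := IccExtend zero_le_one (domRestrict (Icc (0 : ℝ) 1) g) with hg'
  have hg'c : Continuous g' := hgc.domRestrict.Icc_extend'
  have hgg' {t : ℝ} (ht : t ∈ Icc (0 : ℝ) 1) : g' t = g t := by
    rw [hg', IccExtend_of_mem _ _ ht, domRestrict_apply]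
  set F : ℝ → ℂ := fun t => ∫ s in (0 : ℝ)..t, g' s with hF
  have hFd (t : ℝ) : HasDerivAt F (g' t) t :=
    hg'c.integral_hasStrictDerivAt 0 t |>.hasDerivAt
  -- `F` is a logarithm of the direction up to a constant, so this product is constant.
  have hd {t : ℝ} (ht : t ∈ Icc (0 : ℝ) 1) :
      HasDerivWithinAt (fun s => γ.direction s * Complex.exp (-F s)) 0 (Icc 0 1) t := by
    have h1 := (γ.contDiffOn_direction.differentiableOn (by simp) t ht).hasDerivWithinAt
    have h2 := (hFd t).neg.cexp.hasDerivWithinAt (s := Icc 0 1)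
    refine (h1.mul h2).congr_deriv ?_
    have h0 := γ.direction_ne_zero ht
    simp only [hgg' ht, hg, Pi.neg_apply]
    field_simp
    ring
  have hconst := constant_of_derivWithin_zero (fun t ht => (hd ht).differentiableWithinAt)
    (fun t ht => (hd (Ico_subset_Icc_self ht)).derivWithin
      (uniqueDiffOn_Icc zero_lt_one t (Ico_subset_Icc_self ht))) 1 (right_mem_Icc.2 zero_le_one)
  have hF0 : F 0 = 0 := by simp [hF]
  have hV : γ.angleVariation = (F 1).im := by
    have h := Complex.imCLM.intervalIntegral_comp_comm
      (hg'c.intervalIntegrable (μ := MeasureTheory.volume) 0 1)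
    simp only [Complex.imCLM_apply] at h
    rw [hF, ← h, angleVariation]
    refine intervalIntegral.integral_congr fun t ht => ?_
    rw [uIcc_of_le zero_le_one] at ht
    simp only [hgg' ht, hg]
  have hexp : γ.direction 1 = Complex.exp (F 1) * γ.direction 0 := by
    simp only [hF0, neg_zero, Complex.exp_zero, mul_one, Complex.exp_neg] at hconst
    rw [← hconst]
    field_simp [Complex.exp_ne_zero]
  rw [hexp, Complex.arg_mul_coe_angle (Complex.exp_ne_zero _)
    (γ.direction_ne_zero (left_mem_Icc.2 zero_le_one)), Complex.arg_exp, Real.Angle.coe_toIocMod, hV]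
  simp

/-! ### Fronts near a common starting point -/

theorem velocity_zero_nonneg (γ : LegendrianCurve) {c d : ℝ} (hcd : c < d)
    (hsub : Icc c d ⊆ Icc 0 1) (hmono : MonotoneOn (fun t => γ t 0) (Icc c d)) {t : ℝ}
    (ht : t ∈ Icc c d) : 0 ≤ γ.velocity t 0 := by
  rw [← ((γ.hasDerivWithinAt_coord 0 (hsub ht)).mono hsub).derivWithin
    (uniqueDiffOn_Icc hcd t ht)]
  exact hmono.derivWithin_nonneg

/-- If the front of a Legendrian curve is initially a graph whose second derivative at the initial
point is greater (or, for negative `σ`, smaller) than `m`, then it starts above (below) the parabola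
with second derivative `m` which is tangent to it. -/
theorem eventually_parabola (γ : LegendrianCurve) {ε : ℝ} (hε : ε ∈ Ioc (0 : ℝ) 1)
    (hmono : MonotoneOn (fun t => γ t 0) (Icc 0 ε)) {m σ : ℝ}
    (h : 0 < σ * (γ.velocity 0 1 - m * γ.velocity 0 0)) :
    ∃ δ ∈ Ioc 0 ε, ∀ s ∈ Icc 0 δ, 0 ≤ σ * (γ s 2 - γ 0 2 - γ 0 1 * (γ s 0 - γ 0 0) -
      m / 2 * (γ s 0 - γ 0 0) ^ 2) := by
  have h01 : (0 : ℝ) ∈ Icc (0 : ℝ) 1 := left_mem_Icc.2 zero_le_one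
  have hh : HasDerivWithinAt (fun s => σ * (γ s 1 - m * γ s 0))
      (σ * (γ.velocity 0 1 - m * γ.velocity 0 0)) (Icc 0 1) 0 :=
    ((γ.hasDerivWithinAt_coord 1 h01).sub
      ((γ.hasDerivWithinAt_coord 0 h01).const_mul m)).const_mul σ
  have hev := (hasDerivWithinAt_iff_tendsto_slope.1 hh).eventually (lt_mem_nhds h)
  rw [eventually_nhdsWithin_iff, Metric.eventually_nhds_iff] at hev
  obtain ⟨r, hr, hev⟩ := hev
  refine ⟨min ε (r / 2), ⟨lt_min hε.1 (by linarith), min_le_left _ _⟩, ?_⟩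
  set δ := min ε (r / 2)
  have hδε : δ ≤ ε := min_le_left _ _
  have hδr : δ ≤ r / 2 := min_le_right _ _
  have hsub : Icc 0 δ ⊆ Icc 0 1 := Icc_subset_Icc_right (hδε.trans hε.2)
  have hd {s : ℝ} (hs : s ∈ Icc 0 δ) : HasDerivWithinAt
      (fun s => σ * (γ s 2 - γ 0 2 - γ 0 1 * (γ s 0 - γ 0 0) - m / 2 * (γ s 0 - γ 0 0) ^ 2))
      (σ * (γ s 1 - γ 0 1 - m * (γ s 0 - γ 0 0)) * γ.velocity s 0) (Icc 0 δ) s := by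
    have hx := ((γ.hasDerivWithinAt_coord 0 (hsub hs)).mono hsub).sub_const (γ 0 0)
    have hz := ((γ.hasDerivWithinAt_coord 2 (hsub hs)).mono hsub).sub_const (γ 0 2)
    refine (((hz.sub (hx.const_mul (γ 0 1))).sub ((hx.pow 2).const_mul (m / 2))).const_mul
      σ).congr_deriv ?_
    rw [γ.velocity_two (hsub hs)]
    push_cast
    ring
  -- The derivative is a product: the first factor is positive for small `s > 0` by `hev`, and `x' ≥
  -- 0`.
  have hm := monotoneOn_of_hasDerivWithinAt_nonneg (convex_Icc 0 δ)
    (fun s hs => (hd hs).continuousWithinAt)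
    (fun s hs => (hd (interior_subset hs)).mono interior_subset) fun s hs => by
      rw [interior_Icc] at hs
      refine mul_nonneg ?_ (γ.velocity_zero_nonneg hε.1 (Icc_subset_Icc_right hε.2) hmono
        ⟨hs.1.le, hs.2.le.trans hδε⟩)
      have hpos := hev (y := s) (by
        rw [Real.dist_eq, sub_zero, abs_of_pos hs.1]; linarith [hs.2])
        ⟨hsub ⟨hs.1.le, hs.2.le⟩, hs.1.ne'⟩
      rw [slope_def_field, sub_zero, div_pos_iff_of_pos_right hs.1] at hpos
      linarith
  intro s hs
  have := hm (left_mem_Icc.2 (hs.1.trans hs.2)) hs hs.1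
  simpa using this

/-- Two Legendrian curves starting at the same point, the first one steeper than the second one in
the Lagrangian projection, have points arbitrarily close to the start where the front of the first
one is not below the front of the second one. -/
theorem exists_front_le (γ₁ γ₂ : LegendrianCurve) (h0 : γ₁ 0 = γ₂ 0) {ε : ℝ}
    (hε : ε ∈ Ioc (0 : ℝ) 1) (hm₁ : StrictMonoOn (fun t => γ₁ t 0) (Icc 0 ε))
    (hm₂ : StrictMonoOn (fun t => γ₂ t 0) (Icc 0 ε)) {m : ℝ}
    (h₁ : m * γ₁.velocity 0 0 < γ₁.velocity 0 1) (h₂ : γ₂.velocity 0 1 < m * γ₂.velocity 0 0) :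
    ∃ s ∈ Ioc 0 ε, ∃ t ∈ Ioc 0 ε, γ₁ s 0 = γ₂ t 0 ∧ γ₂ t 2 ≤ γ₁ s 2 := by
  obtain ⟨δ₁, hδ₁, H₁⟩ := γ₁.eventually_parabola hε hm₁.monotoneOn (m := m) (σ := 1) (by linarith)
  obtain ⟨δ₂, hδ₂, H₂⟩ := γ₂.eventually_parabola hε hm₂.monotoneOn (m := m) (σ := -1) (by linarith)
  have hcont (γ : LegendrianCurve) {δ : ℝ} (hδ : δ ≤ ε) :
      ContinuousOn (fun t => γ t 0) (Icc 0 δ) := fun t ht =>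
    ((γ.hasDerivWithinAt_coord 0 ⟨ht.1, (ht.2.trans hδ).trans hε.2⟩).continuousWithinAt).mono
      (Icc_subset_Icc_right (hδ.trans hε.2))
  have hinc₁ := hm₁ (left_mem_Icc.2 hε.1.le) ⟨hδ₁.1.le, hδ₁.2⟩ hδ₁.1
  have hinc₂ := hm₂ (left_mem_Icc.2 hε.1.le) ⟨hδ₂.1.le, hδ₂.2⟩ hδ₂.1
  simp only [← h0] at hinc₁ hinc₂
  -- The smaller of the two final abscissas is attained by both strands; there both are compared
  -- with the same parabola.
  obtain ⟨s, hs, hsX⟩ := intermediate_value_Icc hδ₁.1.le (hcont γ₁ hδ₁.2)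
    (show min (γ₁ δ₁ 0) (γ₂ δ₂ 0) ∈ Icc (γ₁ 0 0) (γ₁ δ₁ 0) from
      ⟨(lt_min hinc₁ hinc₂).le, min_le_left _ _⟩)
  obtain ⟨t, ht, htX⟩ := intermediate_value_Icc hδ₂.1.le (hcont γ₂ hδ₂.2)
    (show min (γ₁ δ₁ 0) (γ₂ δ₂ 0) ∈ Icc (γ₂ 0 0) (γ₂ δ₂ 0) from
      ⟨h0 ▸ (lt_min hinc₁ hinc₂).le, min_le_right _ _⟩)
  simp only at hsX htX
  have hlt := lt_min hinc₁ hinc₂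
  have hs0 : s ≠ 0 := by rintro rfl; exact hlt.ne hsX
  have ht0 : t ≠ 0 := by rintro rfl; rw [← h0] at htX; exact hlt.ne htX
  have hst : γ₁ s 0 = γ₂ t 0 := hsX.trans htX.symm
  refine ⟨s, ⟨hs.1.lt_of_ne' hs0, hs.2.trans hδ₁.2⟩, t, ⟨ht.1.lt_of_ne' ht0, ht.2.trans hδ₂.2⟩,
    hst, ?_⟩
  have e₁ := H₁ s hs
  have e₂ := H₂ t ht
  rw [← h0, ← hst] at e₂
  linarith

/-! ### Lagrangian projection of the velocity -/

/-- The velocity of a Legendrian curve in the Lagrangian projection, as a complex number. -/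
noncomputable def lagrangianVelocity (γ : LegendrianCurve) (t : ℝ) : ℂ :=
  Complex.I * γ.direction t

theorem lagrangianVelocity_re (γ : LegendrianCurve) (t : ℝ) :
    (γ.lagrangianVelocity t).re = γ.velocity t 0 := by
  simp [lagrangianVelocity, direction, frameCoord]

theorem lagrangianVelocity_im (γ : LegendrianCurve) (t : ℝ) :
    (γ.lagrangianVelocity t).im = γ.velocity t 1 := by
  simp [lagrangianVelocity, direction, frameCoord]

theorem lagrangianVelocity_ne_zero (γ : LegendrianCurve) {t : ℝ} (ht : t ∈ Icc (0 : ℝ) 1) :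
    γ.lagrangianVelocity t ≠ 0 :=
  mul_ne_zero Complex.I_ne_zero (γ.direction_ne_zero ht)

theorem direction_div_direction (γ₁ γ₂ : LegendrianCurve) (s t : ℝ) :
    γ₁.direction s / γ₂.direction t = γ₁.lagrangianVelocity s / γ₂.lagrangianVelocity t :=
  (mul_div_mul_left _ _ Complex.I_ne_zero).symm

theorem lagrangianVelocity_reverse (γ : LegendrianCurve) (t : ℝ) :
    γ.reverse.lagrangianVelocity t = -γ.lagrangianVelocity (1 - t) := by
  rw [lagrangianVelocity, lagrangianVelocity, direction_reverse, mul_neg]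

/-- Over a common point, `z' = y x'` recovers the third component linearly from the other two. -/
theorem sameRay_velocity (γ₁ γ₂ : LegendrianCurve) {t : ℝ} (ht : t ∈ Icc (0 : ℝ) 1)
    (heq : γ₁ t = γ₂ t)
    (h : (γ₁.lagrangianVelocity t).arg = (γ₂.lagrangianVelocity t).arg) :
    SameRay ℝ (γ₁.velocity t) (γ₂.velocity t) := by
  obtain ⟨r₁, r₂, hr₁, hr₂, hr⟩ := (Complex.sameRay_iff.2 (Or.inr (Or.inr h))).exists_pos
    (γ₁.lagrangianVelocity_ne_zero ht) (γ₂.lagrangianVelocity_ne_zero ht)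
  have h0 := congrArg Complex.re hr
  have h1 := congrArg Complex.im hr
  simp only [Complex.smul_re, Complex.smul_im, lagrangianVelocity_re, lagrangianVelocity_im,
    smul_eq_mul] at h0 h1
  refine Or.inr (Or.inr ⟨r₁, r₂, hr₁, hr₂, ?_⟩)
  ext i
  fin_cases i
  · simpa using h0
  · simpa using h1
  · have h₁ := γ₁.velocity_two ht
    have h₂ := γ₂.velocity_two ht
    rw [← heq] at h₂
    simp only [Fin.reduceFinMk, PiLp.smul_apply, smul_eq_mul, h₁, h₂]
    linear_combination γ₁ t 1 * h0

end LegendrianCurve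

/-! ### Arguments in the closed right half plane -/

theorem arg_neg_div_coe_angle {u w : ℂ} (hu : u ≠ 0) (hw : w ≠ 0) :
    ((-u / w).arg : Real.Angle) = u.arg - w.arg + Real.pi := by
  rw [Complex.arg_div_coe_angle (neg_ne_zero.2 hu) hw, Complex.arg_neg_coe_angle hu]
  abel

/-- The difference of arguments lies in `(0, π]`, so subtracting `π` gives the principal value. -/
theorem arg_neg_div_of_arg_lt {u w : ℂ} (hu : u ≠ 0) (hw : w ≠ 0) (hu' : 0 ≤ u.re)
    (hw' : 0 ≤ w.re) (h : w.arg < u.arg) : (-u / w).arg = u.arg - w.arg - Real.pi := by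
  have h₁ := abs_le.1 (Complex.abs_arg_le_pi_div_two_iff.2 hu')
  have h₂ := abs_le.1 (Complex.abs_arg_le_pi_div_two_iff.2 hw')
  have hmem : u.arg - w.arg - Real.pi ∈ Ioc (-Real.pi) Real.pi :=
    ⟨by linarith, by linarith [Real.pi_pos]⟩
  rw [← Complex.arg_coe_angle_toReal_eq_arg, ← Real.Angle.toReal_coe_eq_self_iff_mem_Ioc.2 hmem,
    arg_neg_div_coe_angle hu hw, Real.Angle.coe_sub, Real.Angle.coe_sub,
    Real.Angle.sub_coe_pi_eq_add_coe_pi]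

theorem arg_neg_div_of_lt_arg {u w : ℂ} (hu : u ≠ 0) (hw : w ≠ 0) (hu' : 0 ≤ u.re)
    (hw' : 0 ≤ w.re) (h : u.arg < w.arg) : (-u / w).arg = u.arg - w.arg + Real.pi := by
  have h₁ := abs_le.1 (Complex.abs_arg_le_pi_div_two_iff.2 hu')
  have h₂ := abs_le.1 (Complex.abs_arg_le_pi_div_two_iff.2 hw')
  have hmem : u.arg - w.arg + Real.pi ∈ Ioc (-Real.pi) Real.pi :=
    ⟨by linarith [Real.pi_pos], by linarith⟩
  rw [← Complex.arg_coe_angle_toReal_eq_arg, ← Real.Angle.toReal_coe_eq_self_iff_mem_Ioc.2 hmem,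
    arg_neg_div_coe_angle hu hw, Real.Angle.coe_add, Real.Angle.coe_sub]

/-- Two nonzero vectors of the closed right half plane with different directions are separated by
a line of finite slope. -/
theorem exists_slope_between {u w : ℂ} (hu : u ≠ 0) (hw : w ≠ 0) (hu' : 0 ≤ u.re)
    (hw' : 0 ≤ w.re) (h : w.arg < u.arg) : ∃ m : ℝ, m * u.re < u.im ∧ w.im < m * w.re := by
  have h₁ := abs_le.1 (Complex.abs_arg_le_pi_div_two_iff.2 hu')
  have h₂ := abs_le.1 (Complex.abs_arg_le_pi_div_two_iff.2 hw')
  have hπ := Real.pi_pos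
  -- The bisecting direction is never vertical, even if `u` or `w` is.
  set μ := (u.arg + w.arg) / 2 with hμ
  have hc : 0 < Real.cos μ := Real.cos_pos_of_mem_Ioo ⟨by linarith, by linarith⟩
  refine ⟨Real.tan μ, ?_, ?_⟩
  · have hs : 0 < Real.sin (u.arg - μ) := Real.sin_pos_of_pos_of_lt_pi (by linarith) (by linarith)
    rw [Real.sin_sub] at hs
    rw [← Complex.norm_mul_cos_arg u, ← Complex.norm_mul_sin_arg u, Real.tan_eq_sin_div_cos,
      div_mul_eq_mul_div, div_lt_iff₀ hc]
    linarith [mul_pos (norm_pos_iff.2 hu) hs]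
  · have hs : 0 < Real.sin (μ - w.arg) := Real.sin_pos_of_pos_of_lt_pi (by linarith) (by linarith)
    rw [Real.sin_sub] at hs
    rw [← Complex.norm_mul_cos_arg w, ← Complex.norm_mul_sin_arg w, Real.tan_eq_sin_div_cos,
      div_mul_eq_mul_div, lt_div_iff₀ hc]
    linarith [mul_pos (norm_pos_iff.2 hw) hs]

/-! ### Rotation numbers of the cycles -/

namespace LegendrianThetaGraph

variable (G : LegendrianThetaGraph)

theorem two_pi_mul_rotationNumber_cycle {i j : Fin 3} (hij : i ≠ j) :
    2 * Real.pi * (G.cycle i j hij).rotationNumber =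
      (G.edge i).angleVariation - (G.edge j).angleVariation +
      (-(G.edge j).lagrangianVelocity 1 / (G.edge i).lagrangianVelocity 1).arg +
      (-(G.edge i).lagrangianVelocity 0 / (G.edge j).lagrangianVelocity 0).arg := by
  rw [PiecewiseLegendrianKnot.rotationNumber, mul_div_cancel₀ _ Real.two_pi_pos.ne']
  simp only [Fin.sum_univ_two, cycle, Matrix.cons_val_zero, Matrix.cons_val_one, zero_add,
    show (1 : Fin 2) + 1 = 0 from rfl, LegendrianCurve.direction_div_direction,
    LegendrianCurve.lagrangianVelocity_reverse, LegendrianCurve.angleVariation_reverse, sub_zero,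
    sub_self, neg_div, div_neg]
  ring

/-- Modulo `2π` the arguments telescope around the cycle, and the two reversals contribute `π + π =
0`. -/
theorem exists_rotationNumber_cycle_eq_intCast {i j : Fin 3} (hij : i ≠ j) :
    ∃ n : ℤ, (G.cycle i j hij).rotationNumber = n := by
  have h0 : (0 : ℝ) ∈ Icc (0 : ℝ) 1 := left_mem_Icc.2 zero_le_one
  have h1 : (1 : ℝ) ∈ Icc (0 : ℝ) 1 := right_mem_Icc.2 zero_le_one
  have h : ((2 * Real.pi * (G.cycle i j hij).rotationNumber : ℝ) : Real.Angle) = (0 : ℝ) := by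
    have hI {z : ℂ} (hz : z ≠ 0) : ((Complex.I * z).arg : Real.Angle) = Complex.I.arg + z.arg :=
      Complex.arg_mul_coe_angle Complex.I_ne_zero hz
    have hne (k : Fin 3) {t : ℝ} (ht : t ∈ Icc (0 : ℝ) 1) :=
      (G.edge k).lagrangianVelocity_ne_zero ht
    have hne' (k : Fin 3) {t : ℝ} (ht : t ∈ Icc (0 : ℝ) 1) := (G.edge k).direction_ne_zero ht
    rw [G.two_pi_mul_rotationNumber_cycle hij, Real.Angle.coe_add, Real.Angle.coe_add,
      Real.Angle.coe_sub, LegendrianCurve.coe_angleVariation, LegendrianCurve.coe_angleVariation,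
      arg_neg_div_coe_angle (hne j h1) (hne i h1), arg_neg_div_coe_angle (hne i h0) (hne j h0)]
    simp only [LegendrianCurve.lagrangianVelocity, hI (hne' i h0), hI (hne' j h0),
      hI (hne' i h1), hI (hne' j h1)]
    rw [Real.Angle.coe_zero, ← Real.Angle.coe_pi_add_coe_pi]
    abel
  obtain ⟨n, hn⟩ := Real.Angle.angle_eq_iff_two_pi_dvd_sub.1 h
  exact ⟨n, mul_left_cancel₀ Real.two_pi_pos.ne' (by linarith)⟩

variable {G}

theorem IsStandardNearVertices.lagrangianVelocity_zero_re_nonneg (hG : G.IsStandardNearVertices)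
    (i : Fin 3) : 0 ≤ ((G.edge i).lagrangianVelocity 0).re := by
  obtain ⟨ε, hε, h⟩ := hG.right_of_a
  rw [LegendrianCurve.lagrangianVelocity_re]
  exact (G.edge i).velocity_zero_nonneg hε.1 (Icc_subset_Icc_right hε.2) (h i).monotoneOn
    (left_mem_Icc.2 hε.1.le)

theorem IsStandardNearVertices.lagrangianVelocity_one_re_nonneg (hG : G.IsStandardNearVertices)
    (i : Fin 3) : 0 ≤ ((G.edge i).lagrangianVelocity 1).re := by
  obtain ⟨ε, hε, h⟩ := hG.left_of_b
  rw [LegendrianCurve.lagrangianVelocity_re]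
  exact (G.edge i).velocity_zero_nonneg (by linarith [hε.1])
    (Icc_subset_Icc_left (by linarith [hε.2])) (h i).monotoneOn
    (right_mem_Icc.2 (by linarith [hε.1]))

theorem arg_lagrangianVelocity_one_ne {i j : Fin 3} (hij : i ≠ j) :
    ((G.edge i).lagrangianVelocity 1).arg ≠ ((G.edge j).lagrangianVelocity 1).arg := fun h =>
  G.nontangent_b i j hij <| SameRay.neg <| LegendrianCurve.sameRay_velocity _ _
    (right_mem_Icc.2 zero_le_one) ((G.target i).trans (G.target j).symm) h

/-- At the vertex `a`, the order of the strands by height in the front projection is the order of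
their velocities by angle in the Lagrangian projection. -/
theorem IsOrderedAtA.arg_lagrangianVelocity_zero_lt (hord : G.IsOrderedAtA)
    (hG : G.IsStandardNearVertices) {i j : Fin 3} (hij : i < j) :
    ((G.edge j).lagrangianVelocity 0).arg < ((G.edge i).lagrangianVelocity 0).arg := by
  have h0 : (0 : ℝ) ∈ Icc (0 : ℝ) 1 := left_mem_Icc.2 zero_le_one
  have hsrc (i j : Fin 3) : G.edge i 0 = G.edge j 0 := (G.source i).trans (G.source j).symm
  by_contra! hle
  have hlt := hle.lt_of_ne fun h => G.nontangent_a i j hij.ne <|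
    LegendrianCurve.sameRay_velocity _ _ h0 (hsrc i j) h
  obtain ⟨m, hj, hi⟩ := exists_slope_between ((G.edge j).lagrangianVelocity_ne_zero h0)
    ((G.edge i).lagrangianVelocity_ne_zero h0) (hG.lagrangianVelocity_zero_re_nonneg j)
    (hG.lagrangianVelocity_zero_re_nonneg i) hlt
  simp only [LegendrianCurve.lagrangianVelocity_re, LegendrianCurve.lagrangianVelocity_im] at hj hi
  obtain ⟨ε₁, hε₁, hmono⟩ := hG.right_of_a
  obtain ⟨ε₂, hε₂, hz⟩ := hord
  have hm (k : Fin 3) : StrictMonoOn (fun t => G.edge k t 0) (Icc 0 (min ε₁ ε₂)) :=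
    (hmono k).mono (Icc_subset_Icc_right (min_le_left _ _))
  obtain ⟨s, hs, t, ht, hst, hle⟩ := LegendrianCurve.exists_front_le _ _ (hsrc j i)
    ⟨lt_min hε₁.1 hε₂.1, (min_le_left _ _).trans hε₁.2⟩ (hm j) (hm i) hj hi
  exact (hz i j hij t ⟨ht.1, ht.2.trans (min_le_right _ _)⟩ s
    ⟨hs.1, hs.2.trans (min_le_right _ _)⟩ hst.symm).not_ge hle

/-- Up to terms that cancel in cyclic sums, the rotation number of a cycle is `0` or `-1`,
according to the order of its two edges at the vertex `b`. -/
theorem two_pi_mul_rotationNumber_of_lt (hG : G.IsStandardNearVertices) (hord : G.IsOrderedAtA)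
    {i j : Fin 3} (hij : i < j) :
    2 * Real.pi * (G.cycle i j hij.ne).rotationNumber =
      (G.edge i).angleVariation - (G.edge j).angleVariation +
      (((G.edge j).lagrangianVelocity 1).arg - ((G.edge i).lagrangianVelocity 1).arg) +
      (((G.edge i).lagrangianVelocity 0).arg - ((G.edge j).lagrangianVelocity 0).arg) +
      if ((G.edge j).lagrangianVelocity 1).arg < ((G.edge i).lagrangianVelocity 1).arg then 0
        else -(2 * Real.pi) := by
  have h0 : (0 : ℝ) ∈ Icc (0 : ℝ) 1 := left_mem_Icc.2 zero_le_one
  have h1 : (1 : ℝ) ∈ Icc (0 : ℝ) 1 := right_mem_Icc.2 zero_le_one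
  rw [G.two_pi_mul_rotationNumber_cycle hij.ne,
    arg_neg_div_of_arg_lt ((G.edge i).lagrangianVelocity_ne_zero h0)
      ((G.edge j).lagrangianVelocity_ne_zero h0) (hG.lagrangianVelocity_zero_re_nonneg i)
      (hG.lagrangianVelocity_zero_re_nonneg j) (hord.arg_lagrangianVelocity_zero_lt hG hij)]
  -- The corner at `a` gives `-π`; the one at `b` either cancels or doubles it.
  split_ifs with h
  · rw [arg_neg_div_of_lt_arg ((G.edge j).lagrangianVelocity_ne_zero h1)
      ((G.edge i).lagrangianVelocity_ne_zero h1) (hG.lagrangianVelocity_one_re_nonneg j)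
      (hG.lagrangianVelocity_one_re_nonneg i) h]
    ring
  · rw [arg_neg_div_of_arg_lt ((G.edge j).lagrangianVelocity_ne_zero h1)
      ((G.edge i).lagrangianVelocity_ne_zero h1) (hG.lagrangianVelocity_one_re_nonneg j)
      (hG.lagrangianVelocity_one_re_nonneg i)
      ((not_lt.1 h).lt_of_ne (arg_lagrangianVelocity_one_ne hij.ne))]
    ring

end LegendrianThetaGraph

theorem mainTheorem2 (G : LegendrianThetaGraph) (hstd : G.IsStandardNearVertices)
    (hord : G.IsOrderedAtA) :
    ∃ rot₁ rot₂ rot₃ : ℤ,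
      G.cycleOne.rotationNumber = rot₁ ∧
      G.cycleTwo.rotationNumber = rot₂ ∧
      G.cycleThree.rotationNumber = rot₃ ∧
      rot₁ - rot₂ + rot₃ ∈ ({0, -1} : Set ℤ) := by
  obtain ⟨n₁, h₁⟩ := G.exists_rotationNumber_cycle_eq_intCast (i := 0) (j := 1) (by decide)
  obtain ⟨n₂, h₂⟩ := G.exists_rotationNumber_cycle_eq_intCast (i := 0) (j := 2) (by decide)
  obtain ⟨n₃, h₃⟩ := G.exists_rotationNumber_cycle_eq_intCast (i := 1) (j := 2) (by decide)
  refine ⟨n₁, n₂, n₃, h₁, h₂, h₃, ?_⟩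
  have e₁ := LegendrianThetaGraph.two_pi_mul_rotationNumber_of_lt hstd hord
    (i := 0) (j := 1) (by decide)
  have e₂ := LegendrianThetaGraph.two_pi_mul_rotationNumber_of_lt hstd hord
    (i := 0) (j := 2) (by decide)
  have e₃ := LegendrianThetaGraph.two_pi_mul_rotationNumber_of_lt hstd hord
    (i := 1) (j := 2) (by decide)
  rw [h₁] at e₁
  rw [h₂] at e₂
  rw [h₃] at e₃
  have h : (n₁ - n₂ + n₃ : ℝ) = 0 ∨ (n₁ - n₂ + n₃ : ℝ) = -1 := by
    have hπ := Real.two_pi_pos.ne'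
    have hcancel {x y : ℝ} (hxy : 2 * Real.pi * x = 2 * Real.pi * y) : x = y :=
      mul_left_cancel₀ hπ hxy
    -- Of the eight sign patterns, the two cyclic ones contradict transitivity at `b`; `linarith`
    -- closes them from the inconsistent inequalities.
    split_ifs at e₁ e₂ e₃ <;>
      first
      | exact Or.inl (hcancel (by linarith))
      | exact Or.inr (hcancel (by linarith))
  rcases h with h | h
  · exact Or.inl (by exact_mod_cast h)
  · exact Or.inr (by exact_mod_cast h)
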